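/- Let $\alpha\in(0,1)$ be irrational with continued fraction expansion $\alpha=[a_0;a_1,a_2,\ldots]$, where $a_0=\lfloor\alpha\rfloor=0$. Let $s_\alpha$ be any Sturmian word of angle $\alpha$, that is, for some $\rho\in[0,1)$ the infinite word over $\{\mathtt a,\mathtt b\}$ whose $n$th letter ($n\ge 0$) is $\mathtt b$ if $\{\rho+n\alpha\}\in I_{\mathtt b}$ and $\mathtt a$ otherwise, where either $I_{\mathtt b}=[0,1-\alpha)$ or $I_{\mathtt b}=(0,1-\alpha]$ and $\{\cdot\}$ denotes the fractional part. The Parikh vector of a finite word counts the occurrences of each letter, and its norm is the sum of its components. A Parikh vector $P$ is contained in $Q$ if $P$ has strictly smaller norm than $Q$ and $P$ is componentwise at most $Q$. An abelian decomposition of a finite word $w$ is a factorization $w=u_0u_1\cdots u_{j-1}u_j$ with $j\ge 2$ such that $u_1,\ldots,u_{j-1}$ have the same Parikh vector $P$ and the Parikh vectors of $u_0$ and $u_j$ are contained in $P$; if $m=|u_1|$, then $w$ is an abelian power of period $m$ and exponent $|w|/m$ if $w$ has such a decomposition with $u_0$ and $u_j$ empty, and an abelian repetition of period $m$ and exponent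 $|w|/m$ if $w$ has such a decomposition with $j\ge 3$. For every integer $m\ge 1$, let $k_m$ (resp. $k'_m$) be the maximum exponent of an abelian power (resp. abelian repetition) of period $m$ occurring in $s_\alpha$. These maxima exist, the abelian critical exponent $$A(s_\alpha)=\limsup_{m\to\infty}\frac{k_m}{m}=\limsup_{m\to\infty}\frac{k'_m}{m}\in[0,+\infty]$$ is well defined (the two superior limits coincide), the continued fractions $[a_{i+1};a_{i+2},\ldots]$ converge for every $i\ge 0$, and $$A(s_\alpha)=\limsup_{i\to\infty}\bigl([a_{i+1};a_{i+2},\ldots]+[0;a_i,a_{i-1},\ldots,a_1]\bigr),$$ where both sides may be $+\infty$. -/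

import Mathlib

open Filter Topology

namespace AbelianSturmian

/-! ### Abelian powers and abelian repetitions -/

section Words

variable {A : Type*} [Fintype A] [DecidableEq A]

/-- The Parikh vector of a finite word: the number of occurrences of each letter. -/
def parikh (w : List A) : A → ℕ := fun x => w.count x

/-- The norm of a Parikh vector: the sum of its components. -/
def parikhNorm (P : A → ℕ) : ℕ := ∑ x, P x

/-- The Parikh vector `P` is contained in `Q`: it has smaller norm and is componentwise at
most `Q`. -/
def ParikhContained (P Q : A → ℕ) : Prop :=
  parikhNorm P < parikhNorm Q ∧ ∀ x, P x ≤ Q x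

/-- `w = u₀ u₁ ⋯ u_{j-1} u_j` with `u₀ = head`, `[u₁, …, u_{j-1}] = blocks`, `u_j = tail` is an
abelian decomposition of `w` (with `j ≥ 2`) with common Parikh vector `P`. -/
structure IsAbelianDecomposition (w head : List A) (blocks : List (List A)) (tail : List A)
    (P : A → ℕ) : Prop where
  eq_append : w = head ++ blocks.flatten ++ tail
  one_le_length : 1 ≤ blocks.length
  parikh_block : ∀ u ∈ blocks, parikh u = P
  head_contained : ParikhContained (parikh head) P
  tail_contained : ParikhContained (parikh tail) P

/-- `w` is a (possibly degenerated) abelian power of period `m`. -/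
def IsAbelianPower (w : List A) (m : ℕ) : Prop :=
  ∃ (blocks : List (List A)) (P : A → ℕ),
    IsAbelianDecomposition w [] blocks [] P ∧ parikhNorm P = m

/-- `w` is an abelian repetition of period `m`: it has an abelian decomposition
`u₀ u₁ ⋯ u_{j-1} u_j` with `j ≥ 3` and `|u₁| = m`. -/
def IsAbelianRepetition (w : List A) (m : ℕ) : Prop :=
  ∃ (head : List A) (blocks : List (List A)) (tail : List A) (P : A → ℕ),
    IsAbelianDecomposition w head blocks tail P ∧ 2 ≤ blocks.length ∧ parikhNorm P = m

/-- The finite word `w` occurs in the infinite word `s`. -/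
def IsFactor {B : Type*} (w : List B) (s : ℕ → B) : Prop :=
  ∃ n : ℕ, w = (List.range w.length).map fun i => s (n + i)

/-- The exponents of the abelian powers of period `m` occurring in `s`. -/
def powerExponents (s : ℕ → A) (m : ℕ) : Set ℝ :=
  {e | ∃ w : List A, IsFactor w s ∧ IsAbelianPower w m ∧ e = (w.length : ℝ) / m}

/-- The exponents of the abelian repetitions of period `m` occurring in `s`. -/
def repetitionExponents (s : ℕ → A) (m : ℕ) : Set ℝ :=
  {e | ∃ w : List A, IsFactor w s ∧ IsAbelianRepetition w m ∧ e = (w.length : ℝ) / m}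

/-- `k_m`, the maximum exponent of an abelian power of period `m` in `s`. -/
noncomputable def maxPowerExponent (s : ℕ → A) (m : ℕ) : ℝ := sSup (powerExponents s m)

/-- `k'_m`, the maximum exponent of an abelian repetition of period `m` in `s`. -/
noncomputable def maxRepetitionExponent (s : ℕ → A) (m : ℕ) : ℝ := sSup (repetitionExponents s m)

/-- The abelian critical exponent `A(s) = limsup k_m / m`, possibly `+∞`. -/
noncomputable def abelianCriticalExponent (s : ℕ → A) : EReal :=
  limsup (fun m : ℕ => ((maxPowerExponent s m / m : ℝ) : EReal)) atTop

end Words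

/-! ### Sturmian words -/

/-- The binary alphabet. -/
inductive Letter where
  | a : Letter
  | b : Letter
  deriving DecidableEq

instance : Fintype Letter := ⟨{Letter.a, Letter.b}, fun x => by cases x <;> simp⟩

/-- The Sturmian word of angle `α` and initial point `ρ` coded by the intervals
`I_b = [0, 1 - α)` and `I_a = [1 - α, 1)`. -/
noncomputable def lowerSturmian (α ρ : ℝ) : ℕ → Letter := fun n =>
  if Int.fract (ρ + n * α) ∈ Set.Ico 0 (1 - α) then Letter.b else Letter.a

/-- The Sturmian word of angle `α` and initial point `ρ` coded by the intervals
`I_b = (0, 1 - α]` and `I_a = (1 - α, 1]` of the torus (where `0` and `1` are the same point, so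
that it lies in `I_a`). -/
noncomputable def upperSturmian (α ρ : ℝ) : ℕ → Letter := fun n =>
  if Int.fract (ρ + n * α) ∈ Set.Ioc 0 (1 - α) then Letter.b else Letter.a

/-- `s` is a Sturmian word of angle `α`. -/
def IsSturmian (α : ℝ) (s : ℕ → Letter) : Prop :=
  (0 < α ∧ α < 1) ∧ Irrational α ∧
    ∃ ρ ∈ Set.Ico (0 : ℝ) 1, s = lowerSturmian α ρ ∨ s = upperSturmian α ρ

/-! ### Continued fractions -/

/-- The partial quotients `a₀, a₁, a₂, …` of `α` (the default value `0` never occurs for an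
irrational `α`). -/
noncomputable def partialQuotient (α : ℝ) : ℕ → ℝ
  | 0 => (GenContFract.of α).h
  | n + 1 => ((GenContFract.of α).partDens.get? n).getD 0

/-- The value of the finite continued fraction `[x₀; x₁, …, x_k]`. -/
noncomputable def finiteCF : List ℝ → ℝ
  | [] => 0
  | [x] => x
  | x :: y :: l => x + 1 / finiteCF (y :: l)

/-- The truncation `[x₀; x₁, …, x_n]` of `[x₀; x₁, x₂, …]`. -/
noncomputable def truncatedCF (x : ℕ → ℝ) (n : ℕ) : ℝ := finiteCF ((List.range (n + 1)).map x)

/-- The value of the infinite continued fraction `[x₀; x₁, x₂, …]`: the limit of its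
truncations. -/
noncomputable def infiniteCF (x : ℕ → ℝ) : ℝ := limUnder atTop (truncatedCF x)

/-- `[a_{i+1}; a_{i+2}, …]`, where the `a_j` are the partial quotients of `α`. -/
noncomputable def forwardCF (α : ℝ) (i : ℕ) : ℝ :=
  infiniteCF fun j => partialQuotient α (i + 1 + j)

/-- `[0; a_i, a_{i-1}, …, a₁]`, where the `a_j` are the partial quotients of `α`. -/
noncomputable def backwardCF (α : ℝ) (i : ℕ) : ℝ :=
  finiteCF (0 :: ((List.range i).map fun j => partialQuotient α (j + 1)).reverse)

end AbelianSturmian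

open AbelianSturmian

namespace AbelianSturmian

/-! ### Complete quotients -/

/-- The complete quotients of `ξ`: the `n`th one is `[aₙ; aₙ₊₁, …]`. -/
noncomputable def completeQuotient (ξ : ℝ) (n : ℕ) : ℝ := (fun y => (Int.fract y)⁻¹)^[n] ξ

lemma completeQuotient_zero (ξ : ℝ) : completeQuotient ξ 0 = ξ := rfl

lemma completeQuotient_succ (ξ : ℝ) (n : ℕ) :
    completeQuotient ξ (n + 1) = (Int.fract (completeQuotient ξ n))⁻¹ :=
  Function.iterate_succ_apply' _ _ _

lemma completeQuotient_succ' (ξ : ℝ) (n : ℕ) :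
    completeQuotient ξ (n + 1) = completeQuotient (Int.fract ξ)⁻¹ n :=
  Function.iterate_succ_apply _ _ _

lemma irrational_fract {ξ : ℝ} (h : Irrational ξ) : Irrational (Int.fract ξ) := by
  rw [Int.fract]; exact h.sub_intCast _

lemma fract_pos_of_irrational {ξ : ℝ} (h : Irrational ξ) : 0 < Int.fract ξ :=
  lt_of_le_of_ne (Int.fract_nonneg _) (irrational_fract h).ne_zero.symm

lemma irrational_completeQuotient {ξ : ℝ} (h : Irrational ξ) (n : ℕ) :
    Irrational (completeQuotient ξ n) := by
  induction n with
  | zero => exact h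
  | succ n ih => rw [completeQuotient_succ]; exact (irrational_fract ih).inv

lemma one_lt_completeQuotient_succ {ξ : ℝ} (h : Irrational ξ) (n : ℕ) :
    1 < completeQuotient ξ (n + 1) := by
  rw [completeQuotient_succ]
  exact (one_lt_inv₀ (fract_pos_of_irrational (irrational_completeQuotient h n))).2
    (Int.fract_lt_one _)

/-! ### Partial quotients -/

lemma partialQuotient_zero (ξ : ℝ) : partialQuotient ξ 0 = ⌊ξ⌋ := by
  simp [partialQuotient, GenContFract.of_h_eq_floor]

lemma partialQuotient_succ {ξ : ℝ} (h : Int.fract ξ ≠ 0) (n : ℕ) :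
    partialQuotient ξ (n + 1) = partialQuotient (Int.fract ξ)⁻¹ n := by
  cases n with
  | zero =>
    have := GenContFract.of_s_head h
    rw [Stream'.Seq.head] at this
    simp [partialQuotient, GenContFract.partDens, Stream'.Seq.map_get?, this,
      GenContFract.of_h_eq_floor]
  | succ n =>
    simp [partialQuotient, GenContFract.partDens, Stream'.Seq.map_get?, GenContFract.of_s_succ]

lemma partialQuotient_add {ξ : ℝ} (h : Irrational ξ) (k j : ℕ) :
    partialQuotient ξ (k + j) = partialQuotient (completeQuotient ξ k) j := by
  induction k generalizing ξ with
  | zero => simp [completeQuotient_zero]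
  | succ k ih =>
    rw [completeQuotient_succ', ← ih (irrational_fract h).inv,
      ← partialQuotient_succ (irrational_fract h).ne_zero]
    congr 1; omega

lemma partialQuotient_eq_floor {ξ : ℝ} (h : Irrational ξ) (k : ℕ) :
    partialQuotient ξ k = ⌊completeQuotient ξ k⌋ := by
  rw [← partialQuotient_zero, ← partialQuotient_add h, add_zero]

/-! ### Convergence -/

lemma truncatedCF_zero (x : ℕ → ℝ) : truncatedCF x 0 = x 0 := by
  simp [truncatedCF, finiteCF]

lemma truncatedCF_succ (x : ℕ → ℝ) (n : ℕ) :
    truncatedCF x (n + 1) = x 0 + 1 / truncatedCF (fun j => x (j + 1)) n := by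
  simp only [truncatedCF]
  rw [List.range_succ_eq_map (n := n + 1), List.map_cons, List.map_map, List.range_succ_eq_map,
    List.map_cons, finiteCF, List.map_cons]
  rfl

lemma truncatedCF_partialQuotient {ξ : ℝ} (h : Irrational ξ) (n : ℕ) :
    truncatedCF (partialQuotient ξ) n = ξ.convergent n := by
  induction n generalizing ξ with
  | zero => simp [truncatedCF_zero, partialQuotient_zero]
  | succ n ih =>
    rw [truncatedCF_succ, Real.convergent_succ, partialQuotient_zero]
    have : (fun j => partialQuotient ξ (j + 1)) = partialQuotient (Int.fract ξ)⁻¹ :=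
      funext fun j => partialQuotient_succ (irrational_fract h).ne_zero j
    rw [this, ih (irrational_fract h).inv]
    simp

lemma tendsto_truncatedCF {ξ : ℝ} (h : Irrational ξ) (k : ℕ) :
    Tendsto (truncatedCF fun j => partialQuotient ξ (k + j)) atTop
      (𝓝 (completeQuotient ξ k)) := by
  have h' := irrational_completeQuotient h k
  have e : (fun j => partialQuotient ξ (k + j)) = partialQuotient (completeQuotient ξ k) :=
    funext fun j => partialQuotient_add h k j
  rw [e]
  refine (GenContFract.of_convergence (completeQuotient ξ k)).congr fun n => ?_
  rw [truncatedCF_partialQuotient h', Real.convs_eq_convergent]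

lemma forwardCF_eq {ξ : ℝ} (h : Irrational ξ) (i : ℕ) :
    forwardCF ξ i = completeQuotient ξ (i + 1) :=
  (tendsto_truncatedCF h (i + 1)).limUnder_eq

/-! ### Numerators and denominators of the convergents -/

/-- The denominators of the convergents, shifted by one: `cfDen ξ (n + 1) = qₙ`, `q₋₁ = 0`. -/
noncomputable def cfDen (ξ : ℝ) : ℕ → ℤ
  | 0 => 0
  | 1 => 1
  | n + 2 => ⌊completeQuotient ξ (n + 1)⌋ * cfDen ξ (n + 1) + cfDen ξ n

/-- The numerators of the convergents, shifted by one: `cfNum ξ (n + 1) = pₙ`, `p₋₁ = 1`. -/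
noncomputable def cfNum (ξ : ℝ) : ℕ → ℤ
  | 0 => 1
  | 1 => ⌊ξ⌋
  | n + 2 => ⌊completeQuotient ξ (n + 1)⌋ * cfNum ξ (n + 1) + cfNum ξ n

/-- The approximation error `qₙ ξ - pₙ`, shifted by one. -/
noncomputable def cfError (ξ : ℝ) (n : ℕ) : ℝ := cfDen ξ n * ξ - cfNum ξ n

lemma cfError_add_two (ξ : ℝ) (n : ℕ) :
    cfError ξ (n + 2) = ⌊completeQuotient ξ (n + 1)⌋ * cfError ξ (n + 1) + cfError ξ n := by
  simp only [cfError, cfDen, cfNum]; push_cast; ring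

lemma cfError_succ {ξ : ℝ} (h : Irrational ξ) (n : ℕ) :
    cfError ξ (n + 1) = -(Int.fract (completeQuotient ξ n) * cfError ξ n) := by
  induction n with
  | zero => simp [cfError, cfDen, cfNum, completeQuotient_zero]
  | succ n ih =>
    have hf := (fract_pos_of_irrational (irrational_completeQuotient h n)).ne'
    have : cfError ξ n = -(completeQuotient ξ (n + 1) * cfError ξ (n + 1)) := by
      rw [ih, completeQuotient_succ]; field_simp
    rw [cfError_add_two, this, Int.fract]
    ring

lemma cfError_ne_zero {ξ : ℝ} (h : Irrational ξ) (n : ℕ) : cfError ξ n ≠ 0 := by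
  induction n with
  | zero => simp [cfError, cfDen, cfNum]
  | succ n ih =>
    rw [cfError_succ h]
    exact neg_ne_zero.2 (mul_ne_zero
      (fract_pos_of_irrational (irrational_completeQuotient h n)).ne' ih)

lemma cfError_mul_neg {ξ : ℝ} (h : Irrational ξ) (n : ℕ) :
    cfError ξ n * cfError ξ (n + 1) < 0 := by
  rw [cfError_succ h]
  have h1 := fract_pos_of_irrational (irrational_completeQuotient h n)
  have h2 := mul_self_pos.2 (cfError_ne_zero h n)
  nlinarith [mul_pos h1 h2]

lemma one_le_floor_completeQuotient {ξ : ℝ} (h : Irrational ξ) (n : ℕ) :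
    1 ≤ ⌊completeQuotient ξ (n + 1)⌋ :=
  Int.le_floor.2 (by exact_mod_cast (one_lt_completeQuotient_succ h n).le)

lemma cfDen_nonneg_and_succ_pos {ξ : ℝ} (h : Irrational ξ) (n : ℕ) :
    0 ≤ cfDen ξ n ∧ 0 < cfDen ξ (n + 1) := by
  induction n with
  | zero => simp [cfDen]
  | succ n ih =>
    refine ⟨ih.2.le, ?_⟩
    have := one_le_floor_completeQuotient h n
    simp only [cfDen]
    nlinarith [ih.1, ih.2]

lemma cfDen_succ_pos {ξ : ℝ} (h : Irrational ξ) (n : ℕ) : 0 < cfDen ξ (n + 1) :=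
  (cfDen_nonneg_and_succ_pos h n).2

lemma add_le_cfDen_add_two {ξ : ℝ} (h : Irrational ξ) (n : ℕ) :
    cfDen ξ (n + 1) + cfDen ξ n ≤ cfDen ξ (n + 2) := by
  have := one_le_floor_completeQuotient h n
  simp only [cfDen]
  nlinarith [cfDen_succ_pos h n]

lemma le_cfDen_succ {ξ : ℝ} (h : Irrational ξ) (n : ℕ) : (n : ℤ) ≤ cfDen ξ (n + 1) := by
  induction n with
  | zero => simp [cfDen]
  | succ n ih =>
    cases n with
    | zero => exact cfDen_succ_pos h 1
    | succ n =>
      have : cfDen ξ (n + 1 + 1) + cfDen ξ (n + 1) ≤ cfDen ξ (n + 1 + 1 + 1) :=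
        add_le_cfDen_add_two h (n + 1)
      have := cfDen_succ_pos h n
      push_cast at *; omega

lemma mul_abs_cfError {ξ : ℝ} (h : Irrational ξ) (n : ℕ) :
    (completeQuotient ξ (n + 1) * cfDen ξ (n + 1) + cfDen ξ n) * |cfError ξ (n + 1)| = 1 := by
  induction n with
  | zero =>
    have h0 := fract_pos_of_irrational h
    have : cfError ξ 1 = Int.fract ξ := by simp [cfError, cfDen, cfNum]
    rw [zero_add, this, completeQuotient_succ, abs_of_pos h0, completeQuotient_zero]
    simp [cfDen, h0.ne']
  | succ n ih =>
    have h0 := fract_pos_of_irrational (irrational_completeQuotient h (n + 1))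
    rw [cfError_succ h, abs_neg, abs_mul, abs_of_pos h0, completeQuotient_succ ξ (n + 1), ← ih,
      ← mul_assoc]
    congr 1
    have e : (cfDen ξ (n + 1 + 1) : ℝ) =
        ⌊completeQuotient ξ (n + 1)⌋ * cfDen ξ (n + 1) + cfDen ξ n := by
      simp [cfDen]
    have e' := Int.floor_add_fract (completeQuotient ξ (n + 1))
    rw [add_mul, mul_right_comm, inv_mul_cancel₀ h0.ne', one_mul, e]
    linear_combination (cfDen ξ (n + 1) : ℝ) * e'

lemma cfDen_mul_cfNum_sub (ξ : ℝ) (n : ℕ) :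
    (cfDen ξ (n + 1) * cfNum ξ n - cfDen ξ n * cfNum ξ (n + 1)) ^ 2 = 1 := by
  induction n with
  | zero => simp [cfDen, cfNum]
  | succ n ih => rw [← ih]; simp only [cfDen, cfNum]; ring

/-- The convergents are best approximations of the second kind. -/
lemma abs_cfError_le {ξ : ℝ} (h : Irrational ξ) (n : ℕ) {q : ℤ} (p : ℤ) (hq : 0 < q)
    (hqn : q < cfDen ξ (n + 2)) : |cfError ξ (n + 1)| ≤ |q * ξ - p| := by
  set d := cfDen ξ (n + 2) * cfNum ξ (n + 1) - cfDen ξ (n + 1) * cfNum ξ (n + 2) with hd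
  have hdd : d * d = 1 := by rw [← sq]; exact cfDen_mul_cfNum_sub ξ (n + 1)
  obtain ⟨u, hu⟩ : ∃ u, u = d * (cfDen ξ (n + 2) * p - cfNum ξ (n + 2) * q) := ⟨_, rfl⟩
  obtain ⟨v, hv⟩ : ∃ v, v = d * (cfNum ξ (n + 1) * q - cfDen ξ (n + 1) * p) := ⟨_, rfl⟩
  have eq : q = u * cfDen ξ (n + 1) + v * cfDen ξ (n + 2) := by
    rw [hu, hv]; linear_combination (-q) * hdd + d * q * hd
  have ep : p = u * cfNum ξ (n + 1) + v * cfNum ξ (n + 2) := by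
    rw [hu, hv]; linear_combination (-p) * hdd + d * p * hd
  have e : (q * ξ - p : ℝ) = u * cfError ξ (n + 1) + v * cfError ξ (n + 2) := by
    rw [eq, ep]; simp only [cfError]; push_cast; ring
  have hp1 := cfDen_succ_pos h n
  have hp2 := cfDen_succ_pos h (n + 1)
  have hu0 : u ≠ 0 := by
    rintro rfl
    rw [zero_mul, zero_add] at eq
    have : 0 < v := by by_contra! hv; nlinarith
    nlinarith
  have huv : u * v ≤ 0 := by
    by_contra! huv
    rcases pos_and_pos_or_neg_and_neg_of_mul_pos huv with ⟨h1, h2⟩ | ⟨h1, h2⟩ <;> nlinarith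
  have hnn : 0 ≤ (u * cfError ξ (n + 1)) * (v * cfError ξ (n + 2)) := by
    have h1 := cfError_mul_neg h (n + 1)
    have h2 : (u * v : ℝ) ≤ 0 := by exact_mod_cast huv
    nlinarith [mul_nonneg_of_nonpos_of_nonpos h2 h1.le]
  have hu1 : (1 : ℝ) ≤ |(u : ℝ)| := by exact_mod_cast Int.one_le_abs hu0
  rw [e, abs_add_eq_add_abs_iff _ _ |>.2 (mul_nonneg_iff.1 hnn), abs_mul]
  have := abs_nonneg (v * cfError ξ (n + 2))
  nlinarith [abs_nonneg (cfError ξ (n + 1))]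

lemma finiteCF_cons {l : List ℝ} (x : ℝ) (hl : l ≠ []) :
    finiteCF (x :: l) = x + 1 / finiteCF l := by
  cases l with
  | nil => exact absurd rfl hl
  | cons y l => rfl

lemma finiteCF_reverse {ξ : ℝ} (h : Irrational ξ) (n : ℕ) :
    finiteCF ((List.range (n + 1)).map fun j => partialQuotient ξ (j + 1)).reverse =
      cfDen ξ (n + 2) / cfDen ξ (n + 1) := by
  induction n with
  | zero => simp [finiteCF, cfDen, partialQuotient_eq_floor h]
  | succ n ih =>
    have h0 : (cfDen ξ (n + 2) : ℝ) ≠ 0 := by exact_mod_cast (cfDen_succ_pos h (n + 1)).ne'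
    rw [List.range_succ, List.map_append, List.reverse_append, List.map_singleton,
      List.reverse_singleton, List.singleton_append, finiteCF_cons _ (by simp), ih,
      partialQuotient_eq_floor h, one_div_div,
      show cfDen ξ (n + 1 + 2) =
        ⌊completeQuotient ξ (n + 1 + 1)⌋ * cfDen ξ (n + 2) + cfDen ξ (n + 1) from rfl]
    push_cast
    field_simp

lemma backwardCF_eq {ξ : ℝ} (h : Irrational ξ) (i : ℕ) :
    backwardCF ξ i = cfDen ξ i / cfDen ξ (i + 1) := by
  cases i with
  | zero => simp [backwardCF, finiteCF, cfDen]
  | succ i =>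
    rw [backwardCF, finiteCF_cons _ (by simp), finiteCF_reverse h]
    simp

lemma forwardCF_add_backwardCF {ξ : ℝ} (h : Irrational ξ) (i : ℕ) :
    forwardCF ξ i + backwardCF ξ i = 1 / (cfDen ξ (i + 1) * |cfError ξ (i + 1)|) := by
  have h0 : (cfDen ξ (i + 1) : ℝ) ≠ 0 := by exact_mod_cast (cfDen_succ_pos h i).ne'
  have h1 : |cfError ξ (i + 1)| ≠ 0 := abs_ne_zero.2 (cfError_ne_zero h _)
  rw [forwardCF_eq h, backwardCF_eq h]
  have := mul_abs_cfError h i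
  field_simp
  linarith

/-! ### Factors and Parikh vectors -/

section Words

variable {A : Type*}

/-- The factor of length `k` of `s` at position `n`. -/
def factorAt (s : ℕ → A) (n k : ℕ) : List A := (List.range k).map fun i => s (n + i)

lemma length_factorAt (s : ℕ → A) (n k : ℕ) : (factorAt s n k).length = k := by
  simp [factorAt]

lemma factorAt_add (s : ℕ → A) (n k l : ℕ) :
    factorAt s n (k + l) = factorAt s n k ++ factorAt s (n + k) l := by
  simp [factorAt, List.range_add, add_assoc, Function.comp_def]

lemma factorAt_succ (s : ℕ → A) (n k : ℕ) :
    factorAt s n (k + 1) = factorAt s n k ++ [s (n + k)] := by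
  rw [factorAt_add]; simp [factorAt]

lemma isFactor_factorAt (s : ℕ → A) (n k : ℕ) : IsFactor (factorAt s n k) s :=
  ⟨n, by rw [length_factorAt]; rfl⟩

lemma IsFactor.exists_eq_factorAt {s : ℕ → A} {u v w : List A} (h : IsFactor (u ++ v ++ w) s) :
    ∃ n, v = factorAt s n v.length := by
  obtain ⟨n, hn⟩ := h
  change _ = factorAt s n _ at hn
  rw [List.length_append, List.length_append, factorAt_add, factorAt_add] at hn
  have h1 := (List.append_inj hn (by simp [length_factorAt])).1
  exact ⟨_, (List.append_inj h1 (by simp [length_factorAt])).2⟩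

lemma factorAt_mul (s : ℕ → A) (n m k : ℕ) :
    factorAt s n (k * m) = ((List.range k).map fun j => factorAt s (n + j * m) m).flatten := by
  induction k with
  | zero => simp [factorAt]
  | succ k ih => rw [add_mul, one_mul, factorAt_add, ih, List.range_succ]; simp

lemma parikhNorm_parikh [Fintype A] [DecidableEq A] (w : List A) : parikhNorm (parikh w) = w.length := by
  induction w with
  | nil => simp [parikhNorm, parikh]
  | cons x w ih =>
    simp only [parikhNorm, parikh] at ih ⊢
    simp [List.count_cons, Finset.sum_add_distrib, ih]

lemma parikh_flatten [DecidableEq A] {P : A → ℕ} {l : List (List A)} (h : ∀ u ∈ l, parikh u = P) (x : A) :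
    parikh l.flatten x = l.length * P x := by
  induction l with
  | nil => simp [parikh]
  | cons u l ih =>
    have h1 := congrFun (h u (by simp)) x
    have h2 := ih fun v hv => h v (by simp [hv])
    simp only [parikh] at h1 h2
    simp only [parikh, List.flatten_cons, List.count_append, h1, h2, List.length_cons]
    ring

lemma length_flatten_of_parikh [Fintype A] [DecidableEq A] {P : A → ℕ} {l : List (List A)}
    (h : ∀ u ∈ l, parikh u = P) :
    l.flatten.length = l.length * parikhNorm P := by
  rw [← parikhNorm_parikh, parikhNorm, parikhNorm, Finset.mul_sum]
  exact Finset.sum_congr rfl fun x _ => parikh_flatten h x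

end Words

/-! ### Letter counts in Sturmian words -/

/-- `s` codes the increments of `F` along the orbit of `ρ` under the translation by `α`, where `F`
rounds the real numbers either down or up. -/
structure IsRotationCoding (α ρ : ℝ) (F : ℝ → ℤ) (s : ℕ → Letter) : Prop where
  abs_sub_lt : ∀ x y, |((F y : ℝ) - y) - (F x - x)| < 1
  apply_eq : ∃ c : ℤ, ∀ (N : ℤ) (x : ℝ), N < x → x < N + 1 → F x = N + c
  apply_succ : ∀ n : ℕ, F (ρ + (n + 1 : ℕ) * α) = F (ρ + n * α) + if s n = Letter.a then 1 else 0

lemma isRotationCoding_lower {α : ℝ} (h0 : 0 < α) (h1 : α < 1) (ρ : ℝ) :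
    IsRotationCoding α ρ Int.floor (lowerSturmian α ρ) where
  abs_sub_lt x y := by
    rw [abs_lt]
    constructor <;> linarith [Int.floor_le x, Int.floor_le y, Int.lt_floor_add_one x,
      Int.lt_floor_add_one y]
  apply_eq := ⟨0, fun N x hx hx' => by rw [add_zero, Int.floor_eq_iff]; exact ⟨hx.le, hx'⟩⟩
  apply_succ n := by
    set x := ρ + n * α with hx
    have e : ρ + (n + 1 : ℕ) * α = x + α := by push_cast; ring
    have hf := Int.floor_add_fract x
    have hf0 := Int.fract_nonneg x
    have hf1 := Int.fract_lt_one x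
    rw [e, Int.floor_eq_iff]
    by_cases hc : Int.fract x < 1 - α
    · have : lowerSturmian α ρ n = Letter.b := by simp [lowerSturmian, ← hx, hc]
      simp only [this, reduceCtorEq, if_false, add_zero]
      constructor <;> linarith
    · have : lowerSturmian α ρ n = Letter.a := by simp [lowerSturmian, ← hx, not_lt.1 hc]
      simp only [this, if_true]
      push_cast
      constructor <;> linarith

lemma isRotationCoding_upper {α : ℝ} (h0 : 0 < α) (h1 : α < 1) (ρ : ℝ) :
    IsRotationCoding α ρ Int.ceil (upperSturmian α ρ) where
  abs_sub_lt x y := by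
    rw [abs_lt]
    constructor <;> linarith [Int.le_ceil x, Int.le_ceil y, Int.ceil_lt_add_one x,
      Int.ceil_lt_add_one y]
  apply_eq := ⟨1, fun N x hx hx' => by
    rw [Int.ceil_eq_iff]; push_cast; exact ⟨by linarith, hx'.le⟩⟩
  apply_succ n := by
    set x := ρ + n * α with hx
    have e : ρ + (n + 1 : ℕ) * α = x + α := by push_cast; ring
    have hf := Int.floor_add_fract x
    have hf1 := Int.fract_lt_one x
    rw [e]
    rcases (Int.fract_nonneg x).eq_or_lt with h | h
    · have : upperSturmian α ρ n = Letter.a := by simp [upperSturmian, ← hx, ← h]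
      have hc : ⌈x⌉ = ⌊x⌋ := by rw [Int.ceil_eq_iff]; constructor <;> linarith
      rw [hc, Int.ceil_eq_iff]
      simp only [this, if_true]
      push_cast
      constructor <;> linarith
    · have hc : ⌈x⌉ = ⌊x⌋ + 1 := by
        rw [Int.ceil_eq_iff]; push_cast; constructor <;> linarith
      rw [hc, Int.ceil_eq_iff]
      by_cases hc : Int.fract x ≤ 1 - α
      · have : upperSturmian α ρ n = Letter.b := by simp [upperSturmian, ← hx, h, hc]
        simp only [this, reduceCtorEq, if_false, add_zero]
        push_cast
        constructor <;> linarith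
      · have : upperSturmian α ρ n = Letter.a := by
          simp [upperSturmian, ← hx, not_le.1 hc]
        simp only [this, if_true]
        push_cast
        constructor <;> linarith

lemma IsSturmian.exists_isRotationCoding {α : ℝ} {s : ℕ → Letter} (h : IsSturmian α s) :
    ∃ ρ F, IsRotationCoding α ρ F s := by
  obtain ⟨⟨h0, h1⟩, -, ρ, -, rfl | rfl⟩ := h
  · exact ⟨_, _, isRotationCoding_lower h0 h1 ρ⟩
  · exact ⟨_, _, isRotationCoding_upper h0 h1 ρ⟩

lemma IsRotationCoding.count_factorAt {α ρ : ℝ} {F : ℝ → ℤ} {s : ℕ → Letter}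
    (h : IsRotationCoding α ρ F s) (n k : ℕ) :
    ((factorAt s n k).count Letter.a : ℤ) = F (ρ + (n + k : ℕ) * α) - F (ρ + n * α) := by
  induction k with
  | zero => simp [factorAt]
  | succ k ih =>
    rw [factorAt_succ, List.count_append, Nat.cast_add, ih, ← add_assoc, h.apply_succ]
    by_cases hc : s (n + k) = Letter.a
    · simp [hc]; ring
    · simp [hc]

/-- The distance from `x` to the nearest integer. -/
noncomputable def distInt (x : ℝ) : ℝ := |x - round x|

lemma exists_natCast_mul_mem_Ioo {α : ℝ} (hα : Irrational α) (ρ : ℝ) {x y : ℝ} (h : x < y) :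
    ∃ (n : ℕ) (N : ℤ), N + x < ρ + n * α ∧ ρ + n * α < N + y := by
  have hd : DenseRange (· • (α : AddCircle (1 : ℝ)) : ℕ → AddCircle (1 : ℝ)) :=
    denseRange_zsmul_iff_nsmul.1 (AddCircle.denseRange_zsmul_coe_iff.2 (by simpa using hα))
  have ho : IsOpen ((fun t : ℝ => (t : AddCircle (1 : ℝ))) '' Set.Ioo (x - ρ) (y - ρ)) :=
    QuotientAddGroup.isOpenMap_coe _ isOpen_Ioo
  obtain ⟨n, t, ht, hn⟩ := hd.exists_mem_open ho
    ((Set.nonempty_Ioo.2 (sub_lt_sub_right h ρ)).image _)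
  have hn' : ((n • α - t : ℝ) : AddCircle (1 : ℝ)) = 0 := by
    rw [AddCircle.coe_sub, AddCircle.coe_nsmul, sub_eq_zero]; exact hn.symm
  obtain ⟨N, hN⟩ := (AddCircle.coe_eq_zero_iff (1 : ℝ)).1 hn'
  rw [zsmul_eq_mul, mul_one, nsmul_eq_mul] at hN
  exact ⟨n, N, by linarith [ht.1], by linarith [ht.2]⟩

/-! ### Abelian powers and repetitions in Sturmian words -/

lemma IsRotationCoding.length_mul_distInt_lt {α ρ : ℝ} {F : ℝ → ℤ} {s : ℕ → Letter}
    (h : IsRotationCoding α ρ F s) {w u v : List Letter} {l : List (List Letter)}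
    {P : Letter → ℕ} (hw : IsFactor w s) (hd : IsAbelianDecomposition w u l v P) :
    l.length * distInt (parikhNorm P * α) < 1 := by
  rw [hd.eq_append] at hw
  obtain ⟨n, hn⟩ := hw.exists_eq_factorAt
  have hc := parikh_flatten hd.parikh_block Letter.a
  rw [parikh, hn, length_flatten_of_parikh hd.parikh_block] at hc
  have hc' := h.count_factorAt n (l.length * parikhNorm P)
  rw [hc] at hc'
  have hlt := h.abs_sub_lt (ρ + n * α) (ρ + (n + l.length * parikhNorm P : ℕ) * α)
  have hc'' : (l.length * P Letter.a : ℝ) =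
      F (ρ + (n + l.length * parikhNorm P : ℕ) * α) - F (ρ + n * α) := by exact_mod_cast hc'
  refine lt_of_le_of_lt ?_ hlt
  calc l.length * distInt (parikhNorm P * α)
      ≤ l.length * |parikhNorm P * α - (P Letter.a : ℤ)| := by
        gcongr; exact round_le _ _
    _ = |(l.length : ℝ) * (parikhNorm P * α - (P Letter.a : ℤ))| := by
        rw [abs_mul, Nat.abs_cast]
    _ = _ := by
        push_cast at *
        rw [← abs_neg]
        congr 1
        linear_combination hc''

lemma IsAbelianDecomposition.length_lt {A : Type*} [Fintype A] [DecidableEq A]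
    {w u v : List A} {l : List (List A)} {P : A → ℕ} (hd : IsAbelianDecomposition w u l v P) :
    w.length < (l.length + 2) * parikhNorm P := by
  have h1 := hd.head_contained.1
  have h2 := hd.tail_contained.1
  rw [parikhNorm_parikh] at h1 h2
  rw [hd.eq_append, List.length_append, List.length_append,
    length_flatten_of_parikh hd.parikh_block]
  linarith

lemma IsRotationCoding.exists_isAbelianDecomposition {α ρ : ℝ} {F : ℝ → ℤ} {s : ℕ → Letter}
    (h : IsRotationCoding α ρ F s) (hα : Irrational α) {m k : ℕ} (hm : 0 < m) (hk : 0 < k)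
    (hmk : k * distInt (m * α) < 1) :
    ∃ w l P, IsFactor w s ∧ IsAbelianDecomposition w [] l [] P ∧ l.length = k ∧
      parikhNorm P = m ∧ w.length = k * m := by
  obtain ⟨p, hp⟩ : ∃ p, p = round (m * α) := ⟨_, rfl⟩
  obtain ⟨ε, hε⟩ : ∃ ε : ℝ, ε = m * α - p := ⟨_, rfl⟩
  have habs : |k * ε| < 1 := by rwa [abs_mul, Nat.abs_cast, hε, hp]
  rw [abs_lt] at habs
  obtain ⟨n, N, hN, hN'⟩ := exists_natCast_mul_mem_Ioo hα ρ
    (x := max 0 (-(k * ε))) (y := min 1 (1 - k * ε))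
    (by simp only [max_lt_iff, lt_min_iff]; refine ⟨⟨?_, ?_⟩, ?_, ?_⟩ <;> linarith)
  obtain ⟨c, hc⟩ := h.apply_eq
  have hF : ∀ j ≤ k, F (ρ + (n + j * m : ℕ) * α) = N + j * p + c := by
    intro j hj
    have hj' : (j : ℝ) ≤ k := by exact_mod_cast hj
    have hj0 : (0 : ℝ) ≤ j := j.cast_nonneg
    have e : ρ + (n + j * m : ℕ) * α = ρ + n * α + j * p + j * ε := by
      rw [hε]; push_cast; ring
    have h1 := le_max_left 0 (-(k * ε))
    have h2 := le_max_right 0 (-(k * ε))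
    have h3 := min_le_left 1 (1 - k * ε)
    have h4 := min_le_right 1 (1 - k * ε)
    rw [e]
    refine hc (N + j * p) _ ?_ ?_ <;> push_cast <;> rcases le_total 0 ε with h0 | h0 <;>
      nlinarith [mul_le_mul_of_nonneg_right hj' (abs_nonneg ε)]
  have hcount : ∀ j < k, ((factorAt s (n + j * m) m).count Letter.a : ℤ) = p := by
    intro j hj
    rw [h.count_factorAt, hF j hj.le, add_assoc,
      show j * m + m = (j + 1) * m by ring, hF (j + 1) hj]
    push_cast; ring
  have hpar : ∀ j < k, parikh (factorAt s (n + j * m) m) = parikh (factorAt s (n + 0 * m) m) := by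
    intro j hj
    have ha : parikh (factorAt s (n + j * m) m) Letter.a =
        parikh (factorAt s (n + 0 * m) m) Letter.a := by
      have := (hcount j hj).trans (hcount 0 hk).symm
      exact_mod_cast this
    have hb := (parikhNorm_parikh (factorAt s (n + j * m) m)).trans
      ((length_factorAt _ _ _).trans
        ((parikhNorm_parikh (factorAt s (n + 0 * m) m)).trans (length_factorAt _ _ _)).symm)
    have hsum : ∀ P : Letter → ℕ, parikhNorm P = P Letter.a + P Letter.b := fun P => by
      rw [parikhNorm, show (Finset.univ : Finset Letter) = {Letter.a, Letter.b} from rfl,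
        Finset.sum_pair (by simp)]
    rw [hsum, hsum] at hb
    funext x
    cases x
    · exact ha
    · omega
  have hnil : ∀ P : Letter → ℕ, parikhNorm P = m → ParikhContained (parikh []) P := by
    intro P hP
    exact ⟨by rw [parikhNorm_parikh, hP]; exact hm, fun x => by simp [parikh]⟩
  have hP : parikhNorm (parikh (factorAt s (n + 0 * m) m)) = m := by
    rw [parikhNorm_parikh, length_factorAt]
  refine ⟨factorAt s n (k * m), (List.range k).map fun j => factorAt s (n + j * m) m,
    parikh (factorAt s (n + 0 * m) m), isFactor_factorAt _ _ _,
    ⟨by simpa using factorAt_mul s n m k, by simpa using Nat.succ_le_of_lt hk, ?_, hnil _ hP, hnil _ hP⟩,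
    by simp, hP, length_factorAt _ _ _⟩
  intro u hu
  obtain ⟨j, hj, rfl⟩ := List.mem_map.1 hu
  exact hpar j (List.mem_range.1 hj)

lemma irrational_natCast_mul {α : ℝ} (hα : Irrational α) {m : ℕ} (hm : 0 < m) :
    Irrational (m * α) := hα.natCast_mul hm.ne'

lemma distInt_pos {x : ℝ} (hx : Irrational x) : 0 < distInt x :=
  abs_pos.2 (hx.sub_intCast _).ne_zero

lemma lt_inv_distInt_iff {x : ℝ} (hx : Irrational x) {y : ℝ} :
    y < (distInt x)⁻¹ ↔ y * distInt x < 1 := by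
  rw [← one_div, lt_div_iff₀ (distInt_pos hx)]

lemma two_lt_inv_distInt {x : ℝ} (hx : Irrational x) : 2 < (distInt x)⁻¹ := by
  rw [lt_inv_comm₀ two_pos (distInt_pos hx)]
  refine lt_of_le_of_ne ((abs_sub_round x).trans_eq (by norm_num)) fun h => ?_
  have h' : Irrational (x - round x) := hx.sub_intCast _
  rcases abs_choice (x - round x) with h1 | h1
  · refine h' ⟨1 / 2, ?_⟩
    rw [← h1, ← distInt, h]; norm_num
  · refine h'.neg ⟨1 / 2, ?_⟩
    rw [← h1, ← distInt, h]; norm_num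

/-- The largest integer smaller than `1 / ‖m α‖`. -/
noncomputable def maxPower (α : ℝ) (m : ℕ) : ℕ := ⌈(distInt (m * α))⁻¹⌉₊ - 1

section Exponents

variable {α ρ : ℝ} {F : ℝ → ℤ} {s : ℕ → Letter} {m : ℕ}

lemma maxPower_bounds (hα : Irrational α) (hm : 0 < m) :
    2 ≤ maxPower α m ∧ (maxPower α m : ℝ) < (distInt (m * α))⁻¹ ∧
      (distInt (m * α))⁻¹ ≤ maxPower α m + 1 := by
  have h2 := two_lt_inv_distInt (irrational_natCast_mul hα hm)
  have h3 : 2 < ⌈(distInt (m * α))⁻¹⌉₊ := Nat.lt_ceil.2 (by exact_mod_cast h2)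
  refine ⟨Nat.le_sub_one_of_lt h3, Nat.lt_ceil.1 (Nat.sub_one_lt (by omega)), ?_⟩
  refine (Nat.le_ceil _).trans ?_
  exact_mod_cast (by unfold maxPower; omega)

lemma IsRotationCoding.length_le_maxPower (h : IsRotationCoding α ρ F s) (hα : Irrational α)
    (hm : 0 < m) {w u v : List Letter} {l : List (List Letter)} {P : Letter → ℕ}
    (hw : IsFactor w s) (hd : IsAbelianDecomposition w u l v P) (hP : parikhNorm P = m) :
    l.length ≤ maxPower α m := by
  have h1 := h.length_mul_distInt_lt hw hd
  rw [hP, ← lt_inv_distInt_iff (irrational_natCast_mul hα hm)] at h1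
  exact Nat.le_sub_one_of_lt (Nat.lt_ceil.2 h1)

lemma IsRotationCoding.isGreatest_powerExponents (h : IsRotationCoding α ρ F s)
    (hα : Irrational α) (hm : 0 < m) :
    IsGreatest (powerExponents s m) (maxPower α m) := by
  have hm' : (m : ℝ) ≠ 0 := by exact_mod_cast hm.ne'
  obtain ⟨h2, h3, -⟩ := maxPower_bounds hα hm
  constructor
  · obtain ⟨w, l, P, hw, hd, -, hP, hl⟩ := h.exists_isAbelianDecomposition hα hm
      (show 0 < maxPower α m by omega)
      ((lt_inv_distInt_iff (irrational_natCast_mul hα hm)).1 h3)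
    refine ⟨w, hw, ⟨l, P, hd, hP⟩, ?_⟩
    rw [hl]; push_cast; field_simp
  · rintro e ⟨w, hw, ⟨l, P, hd, hP⟩, rfl⟩
    have hl := h.length_le_maxPower hα hm hw hd hP
    have : w.length = l.length * m := by
      rw [hd.eq_append, List.nil_append, List.append_nil,
        length_flatten_of_parikh hd.parikh_block, hP]
    rw [this]; push_cast
    rw [mul_div_cancel_right₀ _ hm']
    exact_mod_cast hl

lemma IsRotationCoding.maxPowerExponent_eq (h : IsRotationCoding α ρ F s)
    (hα : Irrational α) (hm : 0 < m) : maxPowerExponent s m = maxPower α m :=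
  (h.isGreatest_powerExponents hα hm).csSup_eq

lemma IsRotationCoding.maxPower_mem_repetitionExponents (h : IsRotationCoding α ρ F s)
    (hα : Irrational α) (hm : 0 < m) : (maxPower α m : ℝ) ∈ repetitionExponents s m := by
  have hm' : (m : ℝ) ≠ 0 := by exact_mod_cast hm.ne'
  obtain ⟨h2, h3, -⟩ := maxPower_bounds hα hm
  obtain ⟨w, l, P, hw, hd, hk, hP, hl⟩ := h.exists_isAbelianDecomposition hα hm
    (show 0 < maxPower α m by omega)
    ((lt_inv_distInt_iff (irrational_natCast_mul hα hm)).1 h3)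
  refine ⟨w, hw, ⟨[], l, [], P, hd, by omega, hP⟩, ?_⟩
  rw [hl]; push_cast; field_simp

lemma IsRotationCoding.exists_of_mem_repetitionExponents (h : IsRotationCoding α ρ F s)
    (hα : Irrational α) (hm : 0 < m) {e : ℝ} (he : e ∈ repetitionExponents s m) :
    ∃ L < (maxPower α m + 2) * m, e = (L : ℝ) / m := by
  obtain ⟨w, hw, ⟨u, l, v, P, hd, -, hP⟩, rfl⟩ := he
  refine ⟨w.length, hd.length_lt.trans_le ?_, rfl⟩
  rw [hP]
  exact Nat.mul_le_mul_right _ (Nat.add_le_add_right (h.length_le_maxPower hα hm hw hd hP) 2)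

lemma IsRotationCoding.isGreatest_repetitionExponents (h : IsRotationCoding α ρ F s)
    (hα : Irrational α) (hm : 0 < m) :
    IsGreatest (repetitionExponents s m) (maxRepetitionExponent s m) := by
  have hfin : (repetitionExponents s m).Finite := by
    refine ((Set.finite_Iio ((maxPower α m + 2) * m)).image fun L : ℕ => (L : ℝ) / m).subset ?_
    intro e he
    obtain ⟨L, hL, rfl⟩ := h.exists_of_mem_repetitionExponents hα hm he
    exact ⟨L, hL, rfl⟩
  exact ⟨Set.Nonempty.csSup_mem ⟨_, h.maxPower_mem_repetitionExponents hα hm⟩ hfin,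
    fun e he => le_csSup hfin.bddAbove he⟩

lemma IsRotationCoding.maxRepetitionExponent_bounds (h : IsRotationCoding α ρ F s)
    (hα : Irrational α) (hm : 0 < m) :
    maxPower α m ≤ maxRepetitionExponent s m ∧ maxRepetitionExponent s m ≤ maxPower α m + 2 := by
  have hg := h.isGreatest_repetitionExponents hα hm
  refine ⟨hg.2 (h.maxPower_mem_repetitionExponents hα hm), ?_⟩
  obtain ⟨L, hL, e⟩ := h.exists_of_mem_repetitionExponents hα hm hg.1
  rw [e, div_le_iff₀ (by exact_mod_cast hm)]
  exact_mod_cast hL.le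

end Exponents

/-! ### Superior limits -/

lemma limsup_coe_le_of_tendsto_sub {f g : ℕ → ℝ} (h : Tendsto (fun n => f n - g n) atTop (𝓝 0)) :
    limsup (fun n => (f n : EReal)) atTop ≤ limsup (fun n => (g n : EReal)) atTop := by
  have h0 : limsup (fun n => ((f n - g n : ℝ) : EReal)) atTop = 0 :=
    (continuous_coe_real_ereal.tendsto 0 |>.comp h).limsup_eq
  have e : (fun n => (f n : EReal)) =
      (fun n => (g n : EReal)) + fun n => ((f n - g n : ℝ) : EReal) := by
    funext n
    rw [Pi.add_apply, ← EReal.coe_add, add_sub_cancel]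
  calc limsup (fun n => (f n : EReal)) atTop
      ≤ limsup (fun n => (g n : EReal)) atTop +
        limsup (fun n => ((f n - g n : ℝ) : EReal)) atTop := by
        rw [e]
        exact EReal.limsup_add_le (.inr (h0 ▸ EReal.zero_ne_top)) (.inr (h0 ▸ EReal.zero_ne_bot))
    _ = _ := by rw [h0, add_zero]

lemma limsup_coe_eq_of_tendsto_sub {f g : ℕ → ℝ} (h : Tendsto (fun n => f n - g n) atTop (𝓝 0)) :
    limsup (fun n => (f n : EReal)) atTop = limsup (fun n => (g n : EReal)) atTop :=
  le_antisymm (limsup_coe_le_of_tendsto_sub h)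
    (limsup_coe_le_of_tendsto_sub (by simpa using h.neg))

lemma tendsto_sub_zero_of_mul_abs_le {f g : ℕ → ℝ} {C : ℝ}
    (h : ∀ m : ℕ, 0 < m → |f m - g m| ≤ C) :
    Tendsto (fun m : ℕ => f m / m - g m / m) atTop (𝓝 0) := by
  refine squeeze_zero_norm' ?_ (tendsto_const_div_atTop_nhds_zero_nat C)
  filter_upwards [eventually_gt_atTop 0] with m hm
  rw [← sub_div, norm_div, Real.norm_eq_abs, Real.norm_eq_abs, Nat.abs_cast]
  gcongr
  exact h m hm

/-- `limsup 1 / (m ‖m α‖)` may be computed along the denominators of the convergents. -/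
lemma limsup_inv_distInt_div {α : ℝ} (hα : Irrational α) :
    limsup (fun m : ℕ => (((distInt (m * α))⁻¹ / m : ℝ) : EReal)) atTop =
      limsup (fun i : ℕ => ((forwardCF α i + backwardCF α i : ℝ) : EReal)) atTop := by
  have hden : ∀ i, ((cfDen α (i + 1)).toNat : ℝ) = cfDen α (i + 1) := fun i => by
    exact_mod_cast Int.toNat_of_nonneg (cfDen_succ_pos hα i).le
  have hE : ∀ i, 0 < |cfError α (i + 1)| := fun i => abs_pos.2 (cfError_ne_zero hα _)
  have hD : ∀ i, (0 : ℝ) < cfDen α (i + 1) := fun i => by exact_mod_cast cfDen_succ_pos hα i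
  apply le_antisymm
  · let I : ℕ → ℕ := fun m => Nat.findGreatest (fun i => cfDen α (i + 1) ≤ m) m
    have hI : Tendsto I atTop atTop := by
      refine tendsto_atTop.2 fun b => ?_
      filter_upwards [eventually_ge_atTop (max b (cfDen α (b + 1)).toNat)] with m hm
      refine Nat.le_findGreatest ((le_max_left _ _).trans hm) ?_
      have := (le_max_right _ _).trans hm
      omega
    refine le_trans ?_ (hI.limsup_comp_le_limsup
      (u := fun i : ℕ => ((forwardCF α i + backwardCF α i : ℝ) : EReal)))
    refine limsup_le_limsup ?_
    filter_upwards [eventually_gt_atTop 0] with m hm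
    have h1 : cfDen α (I m + 1) ≤ m :=
      Nat.findGreatest_spec (P := fun i => cfDen α (i + 1) ≤ m) (Nat.zero_le m)
        (by simpa [cfDen] using Nat.succ_le_of_lt hm)
    have h2 : (m : ℤ) < cfDen α (I m + 2) := by
      by_contra! hle
      have h3 := (le_cfDen_succ hα (I m + 1)).trans hle
      have h4 : I m + 1 ≤ I m := Nat.le_findGreatest (by exact_mod_cast h3) hle
      omega
    have h3 := abs_cfError_le hα (I m) (round (m * α)) (by exact_mod_cast hm) h2
    have h1' : (cfDen α (I m + 1) : ℝ) ≤ m := by exact_mod_cast h1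
    rw [Function.comp_apply, EReal.coe_le_coe_iff, forwardCF_add_backwardCF hα, one_div, mul_inv,
      div_eq_inv_mul]
    have := hE (I m)
    have := hD (I m)
    have hpos := distInt_pos (irrational_natCast_mul hα hm)
    gcongr
    exact_mod_cast h3
  · have hQ : Tendsto (fun i => (cfDen α (i + 1)).toNat) atTop atTop := by
      refine tendsto_atTop_mono (fun i => ?_) tendsto_id
      have := le_cfDen_succ hα i
      simp only [id]; omega
    refine le_trans ?_ (hQ.limsup_comp_le_limsup
      (u := fun m : ℕ => (((distInt (m * α))⁻¹ / m : ℝ) : EReal)))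
    refine limsup_le_limsup (.of_forall fun i => ?_)
    simp only [Function.comp_apply]
    rw [EReal.coe_le_coe_iff, forwardCF_add_backwardCF hα, hden, one_div, mul_inv, div_eq_inv_mul]
    have := hD i
    have hpos : 0 < distInt (cfDen α (i + 1) * α) := by
      rw [← hden]
      exact distInt_pos (irrational_natCast_mul hα (by have := cfDen_succ_pos hα i; omega))
    gcongr
    exact round_le _ _

end AbelianSturmian

theorem mainTheorem5 (α : ℝ) (s : ℕ → Letter) (hs : IsSturmian α s) :
    -- the maxima `k_m` and `k'_m` exist
    (∀ m : ℕ, 0 < m →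
      IsGreatest (powerExponents s m) (maxPowerExponent s m) ∧
      IsGreatest (repetitionExponents s m) (maxRepetitionExponent s m)) ∧
    -- the infinite continued fractions `[a_{i+1}; a_{i+2}, …]` converge
    (∀ i : ℕ, Tendsto (truncatedCF fun j => partialQuotient α (i + 1 + j)) atTop
      (𝓝 (forwardCF α i))) ∧
    -- the two superior limits which define `A(s)` coincide
    abelianCriticalExponent s =
      limsup (fun m : ℕ => ((maxRepetitionExponent s m / m : ℝ) : EReal)) atTop ∧
    -- the formula
    abelianCriticalExponent s =
      limsup (fun i : ℕ => ((forwardCF α i + backwardCF α i : ℝ) : EReal)) atTop := by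
  have hα : Irrational α := hs.2.1
  obtain ⟨ρ, F, h⟩ := hs.exists_isRotationCoding
  refine ⟨fun m hm => ⟨?_, h.isGreatest_repetitionExponents hα hm⟩, fun i => ?_, ?_, ?_⟩
  · rw [h.maxPowerExponent_eq hα hm]
    exact h.isGreatest_powerExponents hα hm
  · rw [forwardCF_eq hα]
    exact tendsto_truncatedCF hα (i + 1)
  · refine limsup_coe_eq_of_tendsto_sub (tendsto_sub_zero_of_mul_abs_le (C := 2) fun m hm => ?_)
    have := h.maxRepetitionExponent_bounds hα hm
    rw [h.maxPowerExponent_eq hα hm, abs_le]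
    constructor <;> linarith
  · rw [← limsup_inv_distInt_div hα]
    refine limsup_coe_eq_of_tendsto_sub (tendsto_sub_zero_of_mul_abs_le (C := 1) fun m hm => ?_)
    have := maxPower_bounds hα hm
    rw [h.maxPowerExponent_eq hα hm, abs_le]
    constructor <;> linarith
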